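/- Let $G$ be a Polish, locally compact abelian group with Haar measure $\lambda$. For a $G$-valued random variable $X$ whose law has a density $f$ with respect to $\lambda$, let $h(X) = -\int_G f\log f\,d\lambda$ be its entropy (well-defined and finite when $f\log f$ is integrable). For $G$-valued random variables $X, Y$ let $$d_R(X\|Y) = h(X'-Y') - h(X'),$$ where $X', Y'$ are independent with the same laws as $X$ and $Y$, respectively. All entropies and Ruzsa divergences appearing below are assumed to be well-defined and finite, and all random variables in each item are defined on a common probability space. (1) If $X, Y_1, Y_2$ are independent, then $d_R(X\|Y_1+Y_2) \le d_R(X\|Y_1) + d_R(X\|Y_2)$. (2) Equivalently, if $X_1, X_2, Y$ are independent, then $d_R(X_1+X_2\|Y) \le d_R(X_1\|Y)$. (3) If $X, Y_1, \dots, Y_k$ are independent, then $$d_R\Big(X\Big\|\sum_{i=1}^k Y_i\Big) \le \sum_{i=1}^k d_R(X\|Y_i),$$ that is, in terms of entropies, $$h\Big(X-\sum_{i=1}^k Y_i\Big) + (k-1)\,h(X) \le \sum_{i=1}^k h(X-Y_i).$$ (4) The entropy of sums of independent random variables is submodular: if $X, Y, Z$ are independent, then $h(X+Y+Z) + h(Z)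 \le h(X+Z) + h(Y+Z)$. As a set function: if $X_1,\dots,X_n$ are independent and $S, T\subseteq\{1,\dots,n\}$, then $$h\Big(\sum_{i\in S\cup T}X_i\Big) + h\Big(\sum_{i\in S\cap T}X_i\Big) \le h\Big(\sum_{i\in S}X_i\Big) + h\Big(\sum_{i\in T}X_i\Big).$$ -/

import Mathlib

open MeasureTheory ProbabilityTheory

noncomputable section

/-- The entropy `h(X) = - ∫ f log f dμ` (natural logarithm, `0 log 0 = 0`) of a `G`-valued random
variable `X` on `(Ω, P)` relative to the Haar measure `μ`, where `f` is the density of the law of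
`X` with respect to `μ`. It is meaningful when `HasFiniteEntropy μ P X` holds. -/
def haarEntropy {G Ω : Type*} [MeasurableSpace G] [MeasurableSpace Ω]
    (μ : Measure G) (P : Measure Ω) (X : Ω → G) : ℝ :=
  - ∫ x, ((P.map X).rnDeriv μ x).toReal * Real.log ((P.map X).rnDeriv μ x).toReal ∂μ

/-- The entropy `h(X)` is well-defined and finite: the law of `X` is absolutely continuous with
respect to `μ`, and its density `f` is such that `f log f` is Lebesgue integrable. -/
def HasFiniteEntropy {G Ω : Type*} [MeasurableSpace G] [MeasurableSpace Ω]
    (μ : Measure G) (P : Measure Ω) (X : Ω → G) : Prop :=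
  P.map X ≪ μ ∧
    Integrable (fun x => ((P.map X).rnDeriv μ x).toReal *
      Real.log ((P.map X).rnDeriv μ x).toReal) μ

/-- The Ruzsa divergence `d_R(X‖Y) = h(X' - Y') - h(X')`, where `X'` and `Y'` are independent with
the same laws as `X` and `Y`; here they are the two coordinates of `G × G` under the product of
the two laws. -/
def ruzsaDiv {G Ω : Type*} [MeasurableSpace G] [AddCommGroup G] [MeasurableSpace Ω]
    (μ : Measure G) (P : Measure Ω) (X Y : Ω → G) : ℝ :=
  haarEntropy μ ((P.map X).prod (P.map Y)) (fun p : G × G => p.1 - p.2) -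
    haarEntropy μ ((P.map X).prod (P.map Y)) (fun p : G × G => p.1)

/-- The Ruzsa divergence `d_R(X‖Y)` is well-defined and finite: both entropies in its definition
are. -/
def HasFiniteRuzsaDiv {G Ω : Type*} [MeasurableSpace G] [AddCommGroup G] [MeasurableSpace Ω]
    (μ : Measure G) (P : Measure Ω) (X Y : Ω → G) : Prop :=
  HasFiniteEntropy μ ((P.map X).prod (P.map Y)) (fun p : G × G => p.1 - p.2) ∧
    HasFiniteEntropy μ ((P.map X).prod (P.map Y)) (fun p : G × G => p.1)

end

/-! Everything reduces to h(X+Y+Z) + h(Z) ≤ h(X+Z) + h(Y+Z). Let `f`, `a`, `b`, `c` be the densities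
of Z, X+Z, Y+Z, X+Y+Z, and put F = a(X+Z) b(Y+Z) / (c(X+Y+Z) f(Z)). Then E F ≤ 1
(`lintegral_density_ratio_le_one`): `f` cancels against the law of Z, and with w = X+Y+Z fixed,
averaging a(w - Y) over Y and b(w - X) over X gives c(w) each time, so what remains is at most ∫ c =
1. Since log F ≤ F - 1, E log F ≤ 0, which is the inequality once the four entropies are finite. For
k summands the bounds log F ≤ F - 1 are added pointwise, before integrating: log-densities of
partial sums cancel as real numbers, so their entropies may be infinite. The divergence statements
follow by replacing Y with -Y. -/

/-! ### Entropy as the mean of the log-density. -/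

section LogDensity

variable {G Ω : Type*} [MeasurableSpace G] [MeasurableSpace Ω] {μ : Measure G} [SigmaFinite μ]
  {P : Measure Ω} [IsProbabilityMeasure P] {W : Ω → G}

/-- The logarithm of the density of the law of `W`, evaluated at `W`. -/
noncomputable def logDensity (μ : Measure G) (P : Measure Ω) (W : Ω → G) (ω : Ω) : ℝ :=
  Real.log ((P.map W).rnDeriv μ (W ω)).toReal

lemma HasFiniteEntropy.integrable_logDensity (hW : Measurable W)
    (h : HasFiniteEntropy μ P W) : Integrable (logDensity μ P W) P := by
  have := Measure.isProbabilityMeasure_map hW.aemeasurable (μ := P)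
  have h2 := (integrable_rnDeriv_smul_iff h.1
    (f := fun x => Real.log ((P.map W).rnDeriv μ x).toReal)).1 h.2
  exact h2.comp_measurable hW

lemma HasFiniteEntropy.haarEntropy_eq (hW : Measurable W)
    (h : HasFiniteEntropy μ P W) : haarEntropy μ P W = -∫ ω, logDensity μ P W ω ∂P := by
  have := Measure.isProbabilityMeasure_map hW.aemeasurable (μ := P)
  have h2 := integral_rnDeriv_smul h.1
    (f := fun x => Real.log ((P.map W).rnDeriv μ x).toReal)
  simp only [smul_eq_mul] at h2
  rw [haarEntropy, h2, integral_map hW.aemeasurable (Measurable.aestronglyMeasurable (by fun_prop))]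
  rfl

/-- A law does not charge the zero set of its own density; this is what later allows logarithms of
products to be split. -/
lemma ae_rnDeriv_map_pos_lt_top (hW : Measurable W) (h : P.map W ≪ μ) :
    ∀ᵐ ω ∂P, 0 < (P.map W).rnDeriv μ (W ω) ∧ (P.map W).rnDeriv μ (W ω) < ⊤ := by
  have := Measure.isProbabilityMeasure_map hW.aemeasurable (μ := P)
  exact ae_of_ae_map hW.aemeasurable
    ((Measure.rnDeriv_pos h).and (h.ae_le (Measure.rnDeriv_lt_top (P.map W) μ)))

end LogDensity

/-! ### Densities of convolutions. -/

section Convolution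

variable {G : Type*} [AddCommGroup G] [MeasurableSpace G] [MeasurableAdd₂ G] [MeasurableNeg G]
  {μ : Measure G} [SigmaFinite μ] [μ.IsAddLeftInvariant]

/-- The density of a convolution `ν ∗ ζ` with `ζ ≪ μ` is the average of the translates of the
density of `ζ`. -/
lemma rnDeriv_conv_ae_eq (ν ζ : Measure G) [IsProbabilityMeasure ν] [IsProbabilityMeasure ζ]
    (hζ : ζ ≪ μ) :
    (ν ∗ ζ).rnDeriv μ =ᵐ[μ] fun w => ∫⁻ x, ζ.rnDeriv μ (w - x) ∂ν := by
  have hm : Measurable fun w => ∫⁻ x, ζ.rnDeriv μ (w - x) ∂ν :=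
    Measurable.lintegral_prod_right' (f := fun p : G × G => ζ.rnDeriv μ (p.1 - p.2)) (by fun_prop)
  have h : ν ∗ ζ = μ.withDensity fun w => ∫⁻ x, ζ.rnDeriv μ (w - x) ∂ν := by
    refine Measure.ext_of_lintegral _ fun g hg => ?_
    rw [Measure.lintegral_conv hg, lintegral_withDensity_eq_lintegral_mul _ hm hg]
    calc ∫⁻ x, ∫⁻ z, g (x + z) ∂ζ ∂ν
        = ∫⁻ x, ∫⁻ w, ζ.rnDeriv μ (w - x) * g w ∂μ ∂ν := by
          refine lintegral_congr fun x => ?_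
          rw [← lintegral_rnDeriv_mul hζ (by fun_prop),
            ← lintegral_add_right_eq_self (μ := μ) (fun w => ζ.rnDeriv μ (w - x) * g w) x]
          simp [add_comm]
      _ = ∫⁻ w, ∫⁻ x, ζ.rnDeriv μ (w - x) * g w ∂ν ∂μ :=
          lintegral_lintegral_swap (by fun_prop)
      _ = _ := by
          refine lintegral_congr fun w => ?_
          rw [lintegral_mul_const _ (by fun_prop)]
          rfl
  rw [h]
  exact Measure.rnDeriv_withDensity _ hm

/-- For the densities `f`, `a`, `b`, `c` of `ζ`, `ν ∗ ζ`, `ρ ∗ ζ`, `ν ∗ (ρ ∗ ζ)`, the function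
`a (x + z) * b (y + z) / (c (x + y + z) * f z)` has integral at most one against `ν ⊗ ρ ⊗ ζ`. -/
lemma lintegral_density_ratio_le_one (ν ρ ζ : Measure G) [IsProbabilityMeasure ν]
    [IsProbabilityMeasure ρ] [IsProbabilityMeasure ζ] (hζ : ζ ≪ μ) :
    ∫⁻ x, ∫⁻ y, ∫⁻ z, (ν ∗ ζ).rnDeriv μ (x + z) * (ρ ∗ ζ).rnDeriv μ (y + z) *
      ((ν ∗ (ρ ∗ ζ)).rnDeriv μ (x + y + z))⁻¹ * (ζ.rnDeriv μ z)⁻¹ ∂ζ ∂ρ ∂ν ≤ 1 := by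
  set a := (ν ∗ ζ).rnDeriv μ with ha
  set b := (ρ ∗ ζ).rnDeriv μ with hb
  set c := (ν ∗ (ρ ∗ ζ)).rnDeriv μ with hc
  set f := ζ.rnDeriv μ with hf
  have ham : Measurable a := Measure.measurable_rnDeriv _ _
  have hbm : Measurable b := Measure.measurable_rnDeriv _ _
  have hcm : Measurable c := Measure.measurable_rnDeriv _ _
  have hfm : Measurable f := Measure.measurable_rnDeriv _ _
  have hcb : c =ᵐ[μ] fun w => ∫⁻ x, b (w - x) ∂ν :=
    rnDeriv_conv_ae_eq ν (ρ ∗ ζ) (Measure.conv_absolutelyContinuous hζ)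
  -- Commutativity of the group lets the same density be averaged over the other variable.
  have hca : c =ᵐ[μ] fun w => ∫⁻ y, a (w - y) ∂ρ := by
    have h : ν ∗ (ρ ∗ ζ) = ρ ∗ (ν ∗ ζ) := by
      rw [← Measure.conv_assoc, Measure.conv_comm ν ρ, Measure.conv_assoc]
    rw [hc, h]
    exact rnDeriv_conv_ae_eq ρ (ν ∗ ζ) (Measure.conv_absolutelyContinuous hζ)
  calc ∫⁻ x, ∫⁻ y, ∫⁻ z, a (x + z) * b (y + z) * (c (x + y + z))⁻¹ * (f z)⁻¹ ∂ζ ∂ρ ∂ν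
      ≤ ∫⁻ x, ∫⁻ y, ∫⁻ w, a (w - y) * b (w - x) * (c w)⁻¹ ∂μ ∂ρ ∂ν := by
        refine lintegral_mono fun x => lintegral_mono fun y => ?_
        dsimp only
        rw [← lintegral_rnDeriv_mul hζ (by fun_prop),
          ← lintegral_add_right_eq_self (μ := μ) (fun w => a (w - y) * b (w - x) * (c w)⁻¹) (x + y)]
        refine lintegral_mono fun z => ?_
        have e1 : z + (x + y) - y = x + z := by abel
        have e2 : z + (x + y) - x = y + z := by abel
        have e3 : z + (x + y) = x + y + z := by abel
        dsimp only
        rw [e1, e2, e3, mul_left_comm]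
        -- Only `≤`: in `ENNReal`, t * t⁻¹ is 0 when t is 0.
        exact mul_le_of_le_one_right' (ENNReal.mul_inv_le_one _)
    _ = ∫⁻ x, ∫⁻ w, (∫⁻ y, a (w - y) ∂ρ) * (b (w - x) * (c w)⁻¹) ∂μ ∂ν := by
        refine lintegral_congr fun x => ?_
        rw [lintegral_lintegral_swap (by fun_prop)]
        refine lintegral_congr fun w => ?_
        simp_rw [mul_assoc]
        rw [lintegral_mul_const _ (by fun_prop)]
    _ = ∫⁻ x, ∫⁻ w, b (w - x) * (c w * (c w)⁻¹) ∂μ ∂ν := by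
        refine lintegral_congr fun x => lintegral_congr_ae ?_
        filter_upwards [hca] with w hw
        rw [← hw, mul_left_comm]
    _ = ∫⁻ w, (∫⁻ x, b (w - x) ∂ν) * (c w * (c w)⁻¹) ∂μ := by
        rw [lintegral_lintegral_swap (by fun_prop)]
        refine lintegral_congr fun w => ?_
        rw [lintegral_mul_const _ (by fun_prop)]
    _ ≤ ∫⁻ w, c w ∂μ := by
        refine lintegral_mono_ae ?_
        filter_upwards [hcb] with w hw
        rw [← hw]
        exact mul_le_of_le_one_right' (ENNReal.mul_inv_le_one _)
    _ ≤ (ν ∗ (ρ ∗ ζ)) Set.univ := Measure.lintegral_rnDeriv_le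
    _ = 1 := measure_univ

end Convolution

/-! ### Submodularity and its iteration. -/

section Submodularity

/-- For an independent family, the sum over a block is independent of the pair of sums over two
blocks disjoint from it. -/
lemma ProbabilityTheory.iIndepFun.indepFun_sum_prodMk {G Ω ι : Type*} [AddCommGroup G]
    [MeasurableSpace G] [MeasurableAdd₂ G] [MeasurableSpace Ω] {P : Measure Ω} {W : ι → Ω → G} (hW : ∀ i, Measurable (W i))
    (h : iIndepFun W P) {A B C : Finset ι} (hAB : Disjoint A B) (hAC : Disjoint A C) :
    IndepFun (∑ i ∈ A, W i) (fun ω => ((∑ i ∈ B, W i) ω, (∑ i ∈ C, W i) ω)) P := by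
  classical
  have hd : Disjoint A (B ∪ C) := Finset.disjoint_union_right.2 ⟨hAB, hAC⟩
  have := (h.indepFun_finset A (B ∪ C) hd hW).comp
    (φ := fun v : A → G => ∑ i, v i)
    (ψ := fun v : ((B ∪ C : Finset ι) → G) =>
      (∑ i : B, v ⟨i, Finset.mem_union_left _ i.2⟩, ∑ i : C, v ⟨i, Finset.mem_union_right _ i.2⟩))
    (by fun_prop) (by fun_prop)
  convert this using 1
  · ext ω
    simpa using (Finset.sum_coe_sort A (fun i => W i ω)).symm
  · ext ω
    · simpa using (Finset.sum_coe_sort B (fun i => W i ω)).symm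
    · simpa using (Finset.sum_coe_sort C (fun i => W i ω)).symm

variable {G : Type*} [AddCommGroup G] [MeasurableSpace G] [MeasurableAdd₂ G] [MeasurableNeg G]
  {μ : Measure G} [SigmaFinite μ] [μ.IsAddLeftInvariant]
  {Ω : Type*} [MeasurableSpace Ω] {P : Measure Ω} [IsProbabilityMeasure P]

/-- Pointwise form of submodularity: the defect of log-densities is dominated by a random variable
of nonpositive mean. No finiteness of entropies is needed. -/
lemma exists_logDensity_defect_le {X Y Z : Ω → G} (hX : Measurable X) (hY : Measurable Y)
    (hZ : Measurable Z) (hYZ : IndepFun Y Z P) (hXYZ : IndepFun X (fun ω => (Y ω, Z ω)) P)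
    (hac : P.map Z ≪ μ) :
    ∃ g : Ω → ℝ, Integrable g P ∧ ∫ ω, g ω ∂P ≤ 0 ∧
      ∀ᵐ ω ∂P, logDensity μ P (X + Z) ω + logDensity μ P (Y + Z) ω
        - logDensity μ P (X + (Y + Z)) ω - logDensity μ P Z ω ≤ g ω := by
  have hXZ : IndepFun X Z P := hXYZ.comp measurable_id measurable_snd
  have hXS : IndepFun X (Y + Z) P := hXYZ.comp measurable_id measurable_add
  have := Measure.isProbabilityMeasure_map hX.aemeasurable (μ := P)
  have := Measure.isProbabilityMeasure_map hY.aemeasurable (μ := P)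
  have := Measure.isProbabilityMeasure_map hZ.aemeasurable (μ := P)
  have ea : P.map (X + Z) = P.map X ∗ P.map Z := hXZ.map_add_eq_map_conv_map hX hZ
  have eb : P.map (Y + Z) = P.map Y ∗ P.map Z := hYZ.map_add_eq_map_conv_map hY hZ
  have ec : P.map (X + (Y + Z)) = P.map X ∗ (P.map Y ∗ P.map Z) := by
    rw [hXS.map_add_eq_map_conv_map hX (hY.add hZ), eb]
  have haca : P.map (X + Z) ≪ μ := ea ▸ Measure.conv_absolutelyContinuous hac
  have hacb : P.map (Y + Z) ≪ μ := eb ▸ Measure.conv_absolutelyContinuous hac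
  have hacc : P.map (X + (Y + Z)) ≪ μ :=
    ec ▸ Measure.conv_absolutelyContinuous (eb ▸ hacb)
  let F : G × G × G → ENNReal := fun p =>
    (P.map (X + Z)).rnDeriv μ (p.1 + p.2.2) * (P.map (Y + Z)).rnDeriv μ (p.2.1 + p.2.2) *
      ((P.map (X + (Y + Z))).rnDeriv μ (p.1 + p.2.1 + p.2.2))⁻¹ * ((P.map Z).rnDeriv μ p.2.2)⁻¹
  have hF : Measurable F := by fun_prop
  have hT : Measurable fun ω => (X ω, Y ω, Z ω) := by fun_prop
  have hlaw : P.map (fun ω => (X ω, Y ω, Z ω)) = (P.map X).prod ((P.map Y).prod (P.map Z)) := by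
    rw [(indepFun_iff_map_prod_eq_prod_map_map hX.aemeasurable (by fun_prop)).1 hXYZ,
      (indepFun_iff_map_prod_eq_prod_map_map hY.aemeasurable hZ.aemeasurable).1 hYZ]
  have hle : ∫⁻ ω, F (X ω, Y ω, Z ω) ∂P ≤ 1 := by
    rw [← lintegral_map hF hT, hlaw, lintegral_prod _ (by fun_prop)]
    refine le_trans (le_of_eq (lintegral_congr fun x => ?_))
      (lintegral_density_ratio_le_one (P.map X) (P.map Y) (P.map Z) hac)
    rw [lintegral_prod _ (by fun_prop), ← ec, ← ea, ← eb]
  have hFT : AEMeasurable (fun ω => F (X ω, Y ω, Z ω)) P := (hF.comp hT).aemeasurable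
  have hint : Integrable (fun ω => (F (X ω, Y ω, Z ω)).toReal) P :=
    integrable_toReal_of_lintegral_ne_top hFT (ne_top_of_le_ne_top ENNReal.one_ne_top hle)
  -- The witness F - 1 comes from log t ≤ t - 1.
  refine ⟨fun ω => (F (X ω, Y ω, Z ω)).toReal - 1, hint.sub (integrable_const 1), ?_, ?_⟩
  · rw [integral_sub hint (integrable_const 1), integral_toReal hFT
      (ae_lt_top' hFT (ne_top_of_le_ne_top ENNReal.one_ne_top hle))]
    have := ENNReal.toReal_mono ENNReal.one_ne_top hle
    simpa using this
  · filter_upwards [ae_rnDeriv_map_pos_lt_top (hX.add hZ) haca,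
      ae_rnDeriv_map_pos_lt_top (hY.add hZ) hacb,
      ae_rnDeriv_map_pos_lt_top (hX.add (hY.add hZ)) hacc,
      ae_rnDeriv_map_pos_lt_top hZ hac] with ω h1 h2 h3 h4
    have p1 := ENNReal.toReal_pos h1.1.ne' h1.2.ne
    have p2 := ENNReal.toReal_pos h2.1.ne' h2.2.ne
    have p3 := ENNReal.toReal_pos h3.1.ne' h3.2.ne
    have p4 := ENNReal.toReal_pos h4.1.ne' h4.2.ne
    have key : (F (X ω, Y ω, Z ω)).toReal =
        ((P.map (X + Z)).rnDeriv μ ((X + Z) ω)).toReal *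
        ((P.map (Y + Z)).rnDeriv μ ((Y + Z) ω)).toReal *
        (((P.map (X + (Y + Z))).rnDeriv μ ((X + (Y + Z)) ω)).toReal)⁻¹ *
        (((P.map Z).rnDeriv μ (Z ω)).toReal)⁻¹ := by
      simp only [F, ENNReal.toReal_mul, ENNReal.toReal_inv, Pi.add_apply, add_assoc]
    rw [key]
    refine le_trans (le_of_eq ?_) (Real.log_le_sub_one_of_pos (by positivity))
    rw [Real.log_mul (by positivity) (by positivity), Real.log_mul (by positivity) (by positivity),
      Real.log_mul (by positivity) (by positivity), Real.log_inv, Real.log_inv]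
    simp only [logDensity]
    ring

/-- Submodularity of the entropy of sums of three independent random variables. -/
lemma haarEntropy_add_add_le {X Y Z : Ω → G} (hX : Measurable X) (hY : Measurable Y)
    (hZ : Measurable Z) (hYZ : IndepFun Y Z P) (hXYZ : IndepFun X (fun ω => (Y ω, Z ω)) P)
    (fZ : HasFiniteEntropy μ P Z) (fXZ : HasFiniteEntropy μ P (X + Z))
    (fYZ : HasFiniteEntropy μ P (Y + Z)) (fS : HasFiniteEntropy μ P (X + (Y + Z))) :
    haarEntropy μ P (X + (Y + Z)) + haarEntropy μ P Z ≤
      haarEntropy μ P (X + Z) + haarEntropy μ P (Y + Z) := by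
  obtain ⟨g, hg, hg0, hle⟩ := exists_logDensity_defect_le hX hY hZ hYZ hXYZ fZ.1
  have iXZ := fXZ.integrable_logDensity (hX.add hZ)
  have iYZ := fYZ.integrable_logDensity (hY.add hZ)
  have iS := fS.integrable_logDensity (hX.add (hY.add hZ))
  have iZ := fZ.integrable_logDensity hZ
  have h := integral_mono_ae (((iXZ.add iYZ).sub iS).sub iZ) hg hle
  rw [integral_sub' ((iXZ.add iYZ).sub iS) iZ, integral_sub' (iXZ.add iYZ) iS,
    integral_add' iXZ iYZ] at h
  rw [fXZ.haarEntropy_eq (hX.add hZ), fYZ.haarEntropy_eq (hY.add hZ),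
    fS.haarEntropy_eq (hX.add (hY.add hZ)), fZ.haarEntropy_eq hZ]
  linarith

/-- Iteration of `exists_logDensity_defect_le` over the summands `W i`, `i ∈ s`. -/
lemma exists_sum_logDensity_defect_le {ι : Type*} {W : ι → Ω → G} (hW : ∀ i, Measurable (W i))
    (h : iIndepFun W P) (j : ι) (hac : P.map (W j) ≪ μ) (s : Finset ι) (hj : j ∉ s) :
    ∃ g : Ω → ℝ, Integrable g P ∧ ∫ ω, g ω ∂P ≤ 0 ∧
      ∀ᵐ ω ∂P, ∑ i ∈ s, logDensity μ P (W j + W i) ω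
        - logDensity μ P (W j + ∑ i ∈ s, W i) ω - (s.card - 1) * logDensity μ P (W j) ω ≤ g ω := by
  classical
  induction s using Finset.induction_on with
  -- The coefficient is -1 here, so the two copies of the log-density of `W j` cancel.
  | empty => exact ⟨0, integrable_zero _ _ _, by simp, by simp⟩
  | insert a s ha ih =>
    rw [Finset.mem_insert, not_or] at hj
    obtain ⟨g, hg, hg0, hgle⟩ := ih hj.2
    have hs : Measurable (∑ i ∈ s, W i) := by fun_prop
    have h1 := h.indepFun_sum_prodMk hW (A := s) (B := {j}) (C := {j})
      (by simpa using hj.2) (by simpa using hj.2)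
    have h2 := h.indepFun_sum_prodMk hW (A := {a}) (B := s) (C := {j})
      (by simpa using ha) (by simpa using Ne.symm hj.1)
    simp only [Finset.sum_singleton] at h1 h2
    obtain ⟨g', hg', hg0', hgle'⟩ := exists_logDensity_defect_le (hW a) hs (hW j)
      (h1.comp measurable_id measurable_fst) h2 hac
    refine ⟨g + g', hg.add hg', ?_, ?_⟩
    · simp only [Pi.add_apply]
      rw [integral_add hg hg']
      linarith
    -- The log-density of `W j + ∑ i ∈ s, W i` occurs in the two bounds with opposite signs.
    · filter_upwards [hgle, hgle'] with ω l1 l2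
      have e : W a + (∑ i ∈ s, W i + W j) = W j + ∑ i ∈ insert a s, W i := by
        rw [Finset.sum_insert ha]; abel
      rw [e, add_comm (W a), add_comm (∑ i ∈ s, W i)] at l2
      rw [Finset.sum_insert (f := fun i => logDensity μ P (W j + W i) ω) ha,
        Finset.card_insert_of_notMem ha]
      simp only [Pi.add_apply]
      push_cast
      linarith

/-- Iterated submodularity, in which the entropies of the intermediate sums need not be finite. -/
lemma haarEntropy_add_sum_le {k : ℕ} {X : Ω → G} {Y : Fin k → Ω → G} (hX : Measurable X)
    (hY : ∀ i, Measurable (Y i)) (h : iIndepFun (Fin.cons X Y : Fin (k + 1) → Ω → G) P)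
    (fX : HasFiniteEntropy μ P X) (fXY : ∀ i, HasFiniteEntropy μ P (X + Y i))
    (fS : HasFiniteEntropy μ P (X + ∑ i, Y i)) :
    haarEntropy μ P (X + ∑ i, Y i) + ((k : ℝ) - 1) * haarEntropy μ P X ≤
      ∑ i, haarEntropy μ P (X + Y i) := by
  have hW : ∀ i, Measurable ((Fin.cons X Y : Fin (k + 1) → Ω → G) i) :=
    Fin.cases (by simpa using hX) (by simpa using hY)
  obtain ⟨g, hg, hg0, hle⟩ := exists_sum_logDensity_defect_le (μ := μ) hW h 0 (by simpa using fX.1)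
    (Finset.univ.map (Fin.succEmb k)) (by simp)
  simp only [Finset.sum_map, Fin.coe_succEmb, Fin.cons_zero, Fin.cons_succ, Finset.card_map,
    Finset.card_univ, Fintype.card_fin] at hle
  have hS : Measurable (X + ∑ i, Y i) := by fun_prop
  have iX := fX.integrable_logDensity hX
  have iXY := fun i => (fXY i).integrable_logDensity (hX.add (hY i))
  have iS := fS.integrable_logDensity hS
  have iSum := integrable_finsetSum Finset.univ fun i _ => iXY i
  have h := integral_mono_ae ((iSum.sub iS).sub (iX.const_mul ((k : ℝ) - 1))) hg hle
  rw [integral_sub' (iSum.sub iS) (iX.const_mul _), integral_sub' iSum iS,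
    integral_finsetSum _ fun i _ => iXY i, integral_const_mul] at h
  rw [fS.haarEntropy_eq hS, fX.haarEntropy_eq hX,
    Finset.sum_congr rfl fun i _ => (fXY i).haarEntropy_eq (hX.add (hY i)),
    Finset.sum_neg_distrib]
  linarith

lemma haarEntropy_sub_sum_le {k : ℕ} {X : Ω → G} {Y : Fin k → Ω → G} (hX : Measurable X)
    (hY : ∀ i, Measurable (Y i)) (h : iIndepFun (Fin.cons X Y : Fin (k + 1) → Ω → G) P)
    (fX : HasFiniteEntropy μ P X) (fXY : ∀ i, HasFiniteEntropy μ P (X - Y i))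
    (fS : HasFiniteEntropy μ P (X - ∑ i, Y i)) :
    haarEntropy μ P (X - ∑ i, Y i) + ((k : ℝ) - 1) * haarEntropy μ P X ≤
      ∑ i, haarEntropy μ P (X - Y i) := by
  have h' : iIndepFun (Fin.cons X (fun i => -Y i) : Fin (k + 1) → Ω → G) P := by
    have := h.comp (Fin.cons id fun _ => Neg.neg : Fin (k + 1) → G → G)
      (Fin.cases measurable_id fun _ => measurable_neg)
    convert this using 2 with i
    exact Fin.cases rfl (fun _ => rfl) i
  simp only [sub_eq_add_neg X, ← Finset.sum_neg_distrib] at fXY fS ⊢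
  exact haarEntropy_add_sum_le hX (fun i => (hY i).neg) h' fX fXY fS

end Submodularity

/-! ### Passage to Ruzsa divergences. -/

section RuzsaDivergence

lemma map_prod_fst_eq {G Ω : Type*} [MeasurableSpace G] [MeasurableSpace Ω] {P : Measure Ω}
    [IsProbabilityMeasure P] {X Y : Ω → G} (hX : Measurable X) (hY : Measurable Y) :
    ((P.map X).prod (P.map Y)).map (fun p : G × G => p.1) = P.map X := by
  have := Measure.isProbabilityMeasure_map hX.aemeasurable (μ := P)
  have := Measure.isProbabilityMeasure_map hY.aemeasurable (μ := P)
  exact Measure.fst_prod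

variable {G : Type*} [AddCommGroup G] [MeasurableSpace G] [MeasurableAdd₂ G] [MeasurableNeg G]
  {μ : Measure G} {Ω : Type*} [MeasurableSpace Ω] {P : Measure Ω} [IsProbabilityMeasure P]
  {X Y : Ω → G}

lemma map_prod_sub_eq (hX : Measurable X) (hY : Measurable Y) (h : IndepFun X Y P) :
    ((P.map X).prod (P.map Y)).map (fun p : G × G => p.1 - p.2) = P.map (X - Y) := by
  rw [← (indepFun_iff_map_prod_eq_prod_map_map hX.aemeasurable hY.aemeasurable).1 h,
    Measure.map_map (by fun_prop) (by fun_prop)]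
  rfl

lemma ruzsaDiv_eq (hX : Measurable X) (hY : Measurable Y) (h : IndepFun X Y P) :
    ruzsaDiv μ P X Y = haarEntropy μ P (X - Y) - haarEntropy μ P X := by
  simp only [ruzsaDiv, haarEntropy, map_prod_sub_eq hX hY h, map_prod_fst_eq hX hY]

lemma hasFiniteRuzsaDiv_iff (hX : Measurable X) (hY : Measurable Y) (h : IndepFun X Y P) :
    HasFiniteRuzsaDiv μ P X Y ↔ HasFiniteEntropy μ P (X - Y) ∧ HasFiniteEntropy μ P X := by
  simp only [HasFiniteRuzsaDiv, HasFiniteEntropy, map_prod_sub_eq hX hY h, map_prod_fst_eq hX hY]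

lemma ruzsaDiv_sum_le [SigmaFinite μ] [μ.IsAddLeftInvariant] {k : ℕ} {Y : Fin k → Ω → G}
    (hX : Measurable X) (hY : ∀ i, Measurable (Y i))
    (h : iIndepFun (Fin.cons X Y : Fin (k + 1) → Ω → G) P)
    (fXY : ∀ i, HasFiniteRuzsaDiv μ P X (Y i)) (fS : HasFiniteRuzsaDiv μ P X (∑ i, Y i)) :
    ruzsaDiv μ P X (∑ i, Y i) ≤ ∑ i, ruzsaDiv μ P X (Y i) := by
  have hW : ∀ i, Measurable ((Fin.cons X Y : Fin (k + 1) → Ω → G) i) :=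
    Fin.cases (by simpa using hX) (by simpa using hY)
  have hS : Measurable (∑ i, Y i) := by fun_prop
  have iXY (i : Fin k) : IndepFun X (Y i) P := by
    simpa using h.indepFun (Fin.succ_ne_zero i).symm
  have iS : IndepFun X (∑ i, Y i) P := by
    simpa using (h.indepFun_finsetSum_of_notMem hW (s := Finset.univ.map (Fin.succEmb k)) (i := 0)
      (by simp)).symm
  simp only [fun i => hasFiniteRuzsaDiv_iff (μ := μ) hX (hY i) (iXY i),
    hasFiniteRuzsaDiv_iff hX hS iS] at fXY fS
  simp only [fun i => ruzsaDiv_eq (μ := μ) hX (hY i) (iXY i), ruzsaDiv_eq hX hS iS]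
  -- Finiteness of h(X) is taken from `fS`, which also covers `k = 0`.
  have := haarEntropy_sub_sum_le hX hY h fS.2 (fun i => (fXY i).1) fS.1
  rw [Finset.sum_sub_distrib, Finset.sum_const, Finset.card_univ, Fintype.card_fin, nsmul_eq_mul]
  linarith

/-- Submodularity for -Y, X₂, X₁ with X₁ as the shared summand, rearranged. -/
lemma ruzsaDiv_add_le [SigmaFinite μ] [μ.IsAddLeftInvariant] {X₁ X₂ Y : Ω → G}
    (hX₁ : Measurable X₁) (hX₂ : Measurable X₂) (hY : Measurable Y)
    (h : iIndepFun ![X₁, X₂, Y] P)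
    (f₁ : HasFiniteRuzsaDiv μ P X₁ Y) (f₁₂ : HasFiniteRuzsaDiv μ P (X₁ + X₂) Y) :
    ruzsaDiv μ P (X₁ + X₂) Y ≤ ruzsaDiv μ P X₁ Y := by
  have hW : ∀ i, Measurable (![X₁, X₂, Y] i) := by
    intro i; fin_cases i <;> assumption
  have i₁ : IndepFun X₁ Y P := h.indepFun (i := 0) (j := 2) (by decide)
  have i₂ : IndepFun (X₁ + X₂) Y P :=
    h.indepFun_add_left hW 0 1 2 (by decide) (by decide)
  have i₁' : IndepFun X₂ (-Y) P :=
    (h.indepFun (i := 1) (j := 2) (by decide)).comp measurable_id measurable_neg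
  rw [hasFiniteRuzsaDiv_iff hX₁ hY i₁] at f₁
  rw [hasFiniteRuzsaDiv_iff (hX₁.add hX₂) hY i₂] at f₁₂
  have e1 : X₁ + X₂ - Y = -Y + (X₂ + X₁) := by abel
  have e2 : X₁ - Y = -Y + X₁ := by abel
  have i₃ : IndepFun (-Y) (fun ω => (X₂ ω, X₁ ω)) P :=
    ((h.indepFun_prodMk hW 1 0 2 (by decide) (by decide)).comp measurable_id measurable_neg).symm
  rw [ruzsaDiv_eq hX₁ hY i₁, ruzsaDiv_eq (hX₁.add hX₂) hY i₂, e1, e2]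
  rw [e1] at f₁₂
  rw [e2] at f₁
  rw [add_comm X₁ X₂] at f₁₂ ⊢
  have := haarEntropy_add_add_le hY.neg hX₂ hX₁
    (h.indepFun (i := 1) (j := 0) (by decide)) i₃ f₁.2 f₁.1 f₁₂.2 f₁₂.1
  linarith

end RuzsaDivergence

theorem theorem3p6 {G : Type*} [AddCommGroup G] [TopologicalSpace G] [IsTopologicalAddGroup G]
    [PolishSpace G] [LocallyCompactSpace G] [MeasurableSpace G] [BorelSpace G]
    (μ : Measure G) [μ.IsAddHaarMeasure]
    {Ω : Type*} [MeasurableSpace Ω] (P : Measure Ω) [IsProbabilityMeasure P] :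
    -- subadditivity in the second argument
    (∀ X Y₁ Y₂ : Ω → G, Measurable X → Measurable Y₁ → Measurable Y₂ →
      iIndepFun ![X, Y₁, Y₂] P →
      HasFiniteRuzsaDiv μ P X Y₁ → HasFiniteRuzsaDiv μ P X Y₂ →
      HasFiniteRuzsaDiv μ P X (Y₁ + Y₂) →
      ruzsaDiv μ P X (Y₁ + Y₂) ≤ ruzsaDiv μ P X Y₁ + ruzsaDiv μ P X Y₂) ∧
    -- monotonicity in the first argument
    (∀ X₁ X₂ Y : Ω → G, Measurable X₁ → Measurable X₂ → Measurable Y →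
      iIndepFun ![X₁, X₂, Y] P →
      HasFiniteRuzsaDiv μ P X₁ Y → HasFiniteRuzsaDiv μ P (X₁ + X₂) Y →
      ruzsaDiv μ P (X₁ + X₂) Y ≤ ruzsaDiv μ P X₁ Y) ∧
    -- subadditivity for any number of summands
    (∀ (k : ℕ) (X : Ω → G) (Y : Fin k → Ω → G), Measurable X → (∀ i, Measurable (Y i)) →
      iIndepFun (Fin.cons X Y : Fin (k + 1) → Ω → G) P →
      (∀ i, HasFiniteRuzsaDiv μ P X (Y i)) → HasFiniteRuzsaDiv μ P X (∑ i, Y i) →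
      ruzsaDiv μ P X (∑ i, Y i) ≤ ∑ i, ruzsaDiv μ P X (Y i)) ∧
    -- the same in terms of entropies
    (∀ (k : ℕ) (X : Ω → G) (Y : Fin k → Ω → G), Measurable X → (∀ i, Measurable (Y i)) →
      iIndepFun (Fin.cons X Y : Fin (k + 1) → Ω → G) P →
      HasFiniteEntropy μ P X → (∀ i, HasFiniteEntropy μ P (X - Y i)) →
      HasFiniteEntropy μ P (X - ∑ i, Y i) →
      haarEntropy μ P (X - ∑ i, Y i) + ((k : ℝ) - 1) * haarEntropy μ P X ≤
        ∑ i, haarEntropy μ P (X - Y i)) ∧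
    -- submodularity of the entropy of sums, for three summands
    (∀ X Y Z : Ω → G, Measurable X → Measurable Y → Measurable Z →
      iIndepFun ![X, Y, Z] P →
      HasFiniteEntropy μ P Z → HasFiniteEntropy μ P (X + Z) → HasFiniteEntropy μ P (Y + Z) →
      HasFiniteEntropy μ P (X + Y + Z) →
      haarEntropy μ P (X + Y + Z) + haarEntropy μ P Z ≤
        haarEntropy μ P (X + Z) + haarEntropy μ P (Y + Z)) ∧
    -- submodularity as a set function
    (∀ (n : ℕ) (X : Fin n → Ω → G), (∀ i, Measurable (X i)) → iIndepFun X P →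
      ∀ S T : Finset (Fin n),
      HasFiniteEntropy μ P (∑ i ∈ S ∪ T, X i) → HasFiniteEntropy μ P (∑ i ∈ S ∩ T, X i) →
      HasFiniteEntropy μ P (∑ i ∈ S, X i) → HasFiniteEntropy μ P (∑ i ∈ T, X i) →
      haarEntropy μ P (∑ i ∈ S ∪ T, X i) + haarEntropy μ P (∑ i ∈ S ∩ T, X i) ≤
        haarEntropy μ P (∑ i ∈ S, X i) + haarEntropy μ P (∑ i ∈ T, X i)) := by
  refine ⟨?_, ?_, ?_, ?_, ?_, ?_⟩
  · intro X Y₁ Y₂ hX hY₁ hY₂ h f₁ f₂ f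
    have := ruzsaDiv_sum_le (μ := μ) (Y := ![Y₁, Y₂]) hX
      (Fin.forall_fin_two.2 ⟨hY₁, hY₂⟩) h (Fin.forall_fin_two.2 ⟨f₁, f₂⟩)
      (by simpa [Fin.sum_univ_two] using f)
    simpa [Fin.sum_univ_two] using this
  · intro X₁ X₂ Y hX₁ hX₂ hY h f₁ f₁₂
    exact ruzsaDiv_add_le hX₁ hX₂ hY h f₁ f₁₂
  · intro k X Y hX hY h fXY fS
    exact ruzsaDiv_sum_le hX hY h fXY fS
  · intro k X Y hX hY h fX fXY fS
    exact haarEntropy_sub_sum_le hX hY h fX fXY fS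
  · intro X Y Z hX hY hZ h fZ fXZ fYZ fS
    have hW : ∀ i, Measurable (![X, Y, Z] i) := by
      intro i; fin_cases i <;> assumption
    rw [add_assoc] at fS ⊢
    exact haarEntropy_add_add_le hX hY hZ (h.indepFun (i := 1) (j := 2) (by decide))
      (h.indepFun_prodMk hW 1 2 0 (by decide) (by decide)).symm fZ fXZ fYZ fS
  · intro n X hX h S T fU fI fS fT
    have hI : Measurable (∑ i ∈ S ∩ T, X i) := by fun_prop
    have hA : Measurable (∑ i ∈ S \ T, X i) := by fun_prop
    have hB : Measurable (∑ i ∈ T \ S, X i) := by fun_prop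
    -- The three independent blocks are S \ T, T \ S and S ∩ T, the last being the shared summand.
    have eS : ∑ i ∈ S, X i = ∑ i ∈ S \ T, X i + ∑ i ∈ S ∩ T, X i :=
      by rw [add_comm, Finset.sum_inter_add_sum_sdiff]
    have eT : ∑ i ∈ T, X i = ∑ i ∈ T \ S, X i + ∑ i ∈ S ∩ T, X i := by
      rw [Finset.inter_comm, add_comm, Finset.sum_inter_add_sum_sdiff]
    have eU : ∑ i ∈ S ∪ T, X i =
        ∑ i ∈ S \ T, X i + (∑ i ∈ T \ S, X i + ∑ i ∈ S ∩ T, X i) := by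
      rw [← eT, ← Finset.sum_union Finset.sdiff_disjoint, Finset.sdiff_union_self_eq_union]
    have dI : Disjoint (S \ T) (S ∩ T) := Finset.disjoint_sdiff_inter S T
    have dI' : Disjoint (T \ S) (S ∩ T) := Finset.inter_comm T S ▸ Finset.disjoint_sdiff_inter T S
    rw [eU] at fU ⊢
    rw [eS] at fS ⊢
    rw [eT] at fT ⊢
    exact haarEntropy_add_add_le hA hB hI
      ((h.indepFun_sum_prodMk hX dI' dI').comp measurable_id measurable_fst)
      (h.indepFun_sum_prodMk hX
        (disjoint_sdiff_sdiff) dI) fI fS fT fU
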